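/- There is a simple nuclear C*-algebra $A$ whose pure state space is not homogeneous, that is, there are pure states $\varphi$ and $\psi$ of $A$ such that no $*$-automorphism $\alpha$ of $A$ satisfies $\varphi\circ\alpha=\psi$; moreover, the same algebra $A$ has a faithful representation on a separable complex Hilbert space. Here a C*-algebra is *simple* if it is nonzero and has no closed two-sided ideals other than $0$ and itself; $A$ is *nuclear* if for every C*-algebra $B$ there is only one C*-norm on the algebraic tensor product $A\odot B$; a *state* is a positive linear functional of norm $1$, and a *pure state* is an extreme point of the convex set of all states; a *faithful representation* of $A$ on a Hilbert space $H$ is an injective $*$-homomorphism $A\to\mathcal B(H)$. -/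

import Mathlib

open scoped TensorProduct ComplexOrder

universe u v

/-- A C⋆-algebra is simple if it is nonzero and its only closed two-sided ideals are `0` and the
whole algebra. (A closed two-sided ring ideal of a C⋆-algebra is automatically a complex subspace,
by approximate units.) -/
def IsSimpleCStarAlgebra (A : Type u) [NonUnitalCStarAlgebra A] : Prop :=
  Nontrivial A ∧ ∀ I : TwoSidedIdeal A, IsClosed (I : Set A) → I = ⊥ ∨ I = ⊤

/-- `p` is a C⋆-norm on the algebraic tensor product of `A` and `B`, a ⋆-algebra with
`(a ⊗ b) * (c ⊗ d) = (a * c) ⊗ (b * d)` and `star (a ⊗ b) = star a ⊗ star b`. -/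
structure IsCStarNorm {A : Type u} {B : Type v} [NonUnitalCStarAlgebra A]
    [NonUnitalCStarAlgebra B] (p : A ⊗[ℂ] B → ℝ) : Prop where
  add_le : ∀ x y, p (x + y) ≤ p x + p y
  smul : ∀ (c : ℂ) (x), p (c • x) = ‖c‖ * p x
  eq_zero : ∀ x, p x = 0 → x = 0
  mul_le : ∀ x y, p (x * y) ≤ p x * p y
  star_mul_self : ∀ x, p (star x * x) = p x ^ 2

/-- A C⋆-algebra `A` is nuclear if for every C⋆-algebra `B` there is only one C⋆-norm on the
algebraic tensor product of `A` and `B`. (There always is one, the spatial norm.) -/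
def IsNuclear (A : Type u) [NonUnitalCStarAlgebra A] : Prop :=
  ∀ (B : Type v) [NonUnitalCStarAlgebra B] (p q : A ⊗[ℂ] B → ℝ),
    IsCStarNorm p → IsCStarNorm q → p = q

/-- The states of a C⋆-algebra: its positive linear functionals of norm one. -/
def stateSpace (A : Type u) [NonUnitalCStarAlgebra A] : Set (StrongDual ℂ A) :=
  {φ | (∀ a : A, 0 ≤ φ (star a * a)) ∧ ‖φ‖ = 1}

/-- The pure states of a C⋆-algebra: the extreme points of its state space. -/
def pureStateSpace (A : Type u) [NonUnitalCStarAlgebra A] : Set (StrongDual ℂ A) :=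
  Set.extremePoints ℝ (stateSpace A)

/-- The pure state space of `A` is homogeneous if for every two pure states `φ` and `ψ` there is
an automorphism `α` of `A` with `φ ∘ α = ψ`. -/
def HasHomogeneousPureStateSpace (A : Type u) [NonUnitalCStarAlgebra A] : Prop :=
  ∀ φ ∈ pureStateSpace A, ∀ ψ ∈ pureStateSpace A, ∃ α : A ≃⋆ₐ[ℂ] A, ∀ a : A, φ (α a) = ψ a

/-- `A` has a faithful representation on a separable complex Hilbert space. -/
def HasFaithfulSeparableRepresentation (A : Type u) [NonUnitalCStarAlgebra A] : Prop :=
  ∃ (H : Type u) (_ : NormedAddCommGroup H) (_ : InnerProductSpace ℂ H) (_ : CompleteSpace H)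
    (_ : TopologicalSpace.SeparableSpace H) (π : A →⋆ₙₐ[ℂ] (H →L[ℂ] H)), Function.Injective π

/-!
The algebra is generated by Pauli operators. Let `F` be the countable group of finitely supported
sequences in `ZMod 2` and `G` the uncountable group of all sequences. On the separable space `ℓ²(F)`
let `F` act by translations and `G` by multiplication with the characters of `F` it defines. The
products of these unitaries, indexed by `V = F × G`, commute up to sign, and the signs separate the
points of `V`; the C⋆-algebra `A` is the closure of their span.

*Simplicity and nuclearity.* `V` is a vector space over a finite field, so finitely many elements
lie in a finite subgroup `K`. On combinations of the `w v`, `v ∈ K`, each component is recovered by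
averaging over conjugations (`component_of_sum`), hence is bounded by the element itself, in any
C⋆-norm on `A ⊗ B` and also in the quotient norm by a proper closed ideal of `A`. Any two such norms
are therefore equivalent up to the order of `K`, and the C⋆-identity `p (h ^ 2) = p h ^ 2` removes
the constant (`IsStarAlgebraCStarNorm.le_of_forall_component`). By density the quotient norm is the
norm, so the ideal is zero, and two C⋆-norms on `A ⊗ B` agree. On a single component `w v ⊗ B` they
agree because a C⋆-algebra has only one C⋆-norm (`IsStarAlgebraCStarNorm.eq_norm`).

*Pure states.* A state that takes the value `1` on a maximal commuting family of self-adjoint `w l`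
has these in its multiplicative domain and vanishes at every `w v` anticommuting with one of them;
so it is determined, and pure (`IsPauliSystem.mem_pureStateSpace`). There is such a state `φ` for
the multiplications, given by the basis vector at `0`, and such a state `ψ` for the translations,
a limit of vector states at indicator functions of finite subgroups. If `φ ∘ α = ψ` for
an automorphism `α`, then `x ↦ α(x) δ₀` maps the multiplications, which are pairwise at distance
`√2` in the seminorm of `ψ`, to an uncountable separated family in `ℓ²(F)`, which is impossible.
-/

/-! ### Norms with the C⋆-identity -/

/-- A C⋆-norm on a complex ⋆-algebra. -/
structure IsStarAlgebraCStarNorm {R : Type*} [NonUnitalRing R] [StarRing R] [Module ℂ R]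
    (p : R → ℝ) : Prop where
  add_le : ∀ x y, p (x + y) ≤ p x + p y
  smul : ∀ (c : ℂ) (x), p (c • x) = ‖c‖ * p x
  eq_zero : ∀ x, p x = 0 → x = 0
  mul_le : ∀ x y, p (x * y) ≤ p x * p y
  star_mul_self : ∀ x, p (star x * x) = p x ^ 2

lemma le_of_forall_pow_two_pow_le {a b C : ℝ} (hb : 0 ≤ b)
    (h : ∀ n : ℕ, a ^ 2 ^ n ≤ C * b ^ 2 ^ n) : a ≤ b := by
  by_contra! hab
  have ha' : 0 < a := hb.trans_lt hab
  have hlim : Filter.Tendsto (fun n : ℕ => C * (b / a) ^ 2 ^ n) Filter.atTop (nhds (C * 0)) :=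
    ((tendsto_pow_atTop_nhds_zero_of_lt_one (by positivity) ((div_lt_one ha').2 hab)).comp
      (tendsto_pow_atTop_atTop_of_one_lt one_lt_two)).const_mul C
  rw [mul_zero] at hlim
  refine absurd (ge_of_tendsto' hlim (b := 1) fun n => ?_) (by norm_num)
  rw [div_pow, ← mul_div_assoc, le_div_iff₀ (by positivity), one_mul]
  exact h n

lemma IsSelfAdjoint.iterate_sq {R : Type*} [NonUnitalRing R] [StarRing R] {h : R}
    (hh : IsSelfAdjoint h) (n : ℕ) :
    IsSelfAdjoint ((fun x : R => x * x)^[n] h) := by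
  induction n with
  | zero => exact hh
  | succ n ih =>
    rw [Function.iterate_succ_apply']
    simp [IsSelfAdjoint, ih.star_eq]

lemma apply_iterate_sq_le {R : Type*} [Mul R] {p : R → ℝ} (hp0 : ∀ x, 0 ≤ p x)
    (hp : ∀ x y, p (x * y) ≤ p x * p y) (h : R) (n : ℕ) :
    p ((fun x : R => x * x)^[n] h) ≤ p h ^ 2 ^ n := by
  induction n with
  | zero => simp
  | succ n ih =>
    rw [Function.iterate_succ_apply', pow_succ, pow_mul, sq]
    exact (hp _ _).trans (mul_self_le_mul_self (hp0 _) ih)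

lemma iterate_sq_mem {R : Type*} [Mul R] {S : Set R} (hS : ∀ x ∈ S, ∀ y ∈ S, x * y ∈ S)
    {h : R} (hh : h ∈ S) (n : ℕ) :
    (fun x : R => x * x)^[n] h ∈ S := by
  induction n with
  | zero => exact hh
  | succ n ih =>
    rw [Function.iterate_succ_apply']
    exact hS _ ih _ ih

section

variable {R : Type*} [NonUnitalRing R] [StarRing R] [Module ℂ R] {p : R → ℝ}

namespace IsStarAlgebraCStarNorm

lemma map_zero (hp : IsStarAlgebraCStarNorm p) : p 0 = 0 := by
  simpa using hp.smul 0 0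

lemma map_neg (hp : IsStarAlgebraCStarNorm p) (x : R) : p (-x) = p x := by
  simpa using hp.smul (-1) x

lemma nonneg (hp : IsStarAlgebraCStarNorm p) (x : R) : 0 ≤ p x := by
  have h := hp.add_le x (-x)
  rw [add_neg_cancel, hp.map_zero, hp.map_neg] at h
  linarith

lemma sum_le (hp : IsStarAlgebraCStarNorm p) {ι : Type*} (s : Finset ι) (f : ι → R) :
    p (∑ i ∈ s, f i) ≤ ∑ i ∈ s, p (f i) := by
  classical
  induction s using Finset.induction_on with
  | empty => simp [hp.map_zero]
  | insert i s hi ih =>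
    rw [Finset.sum_insert hi, Finset.sum_insert hi]
    exact (hp.add_le _ _).trans (by gcongr)

lemma le_map_star (hp : IsStarAlgebraCStarNorm p) (x : R) : p x ≤ p (star x) := by
  rcases (hp.nonneg x).eq_or_lt with h | h
  · exact h ▸ hp.nonneg _
  · have h1 := hp.mul_le (star x) x
    rw [hp.star_mul_self, sq] at h1
    exact le_of_mul_le_mul_right h1 h

lemma map_star (hp : IsStarAlgebraCStarNorm p) (x : R) : p (star x) = p x :=
  le_antisymm (by simpa using hp.le_map_star (star x)) (hp.le_map_star x)

lemma map_eq_of_star_mul_self_eq (hp : IsStarAlgebraCStarNorm p) {x y : R}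
    (h : star x * x = star y * y) : p x = p y := by
  have h1 := hp.star_mul_self x
  rw [h, hp.star_mul_self] at h1
  exact ((sq_eq_sq₀ (hp.nonneg _) (hp.nonneg _)).1 h1).symm

end IsStarAlgebraCStarNorm

lemma IsStarAlgebraCStarNorm.map_iterate_sq (hp : IsStarAlgebraCStarNorm p) {h : R}
    (hh : IsSelfAdjoint h) (n : ℕ) : p ((fun x : R => x * x)^[n] h) = p h ^ 2 ^ n := by
  induction n with
  | zero => simp
  | succ n ih =>
    rw [Function.iterate_succ_apply', pow_succ, pow_mul, ← ih, ← hp.star_mul_self,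
      (hh.iterate_sq n).star_eq]

/-- If a C⋆-norm is dominated by a multiple of a submultiplicative function on a multiplicatively
closed set, then on self-adjoint elements it is dominated by the function itself: the C⋆-norm of
`h ^ 2 ^ n` is the `2 ^ n`-th power of that of `h`, so the constant disappears on taking roots. -/
lemma IsStarAlgebraCStarNorm.le_of_le_mul {q : R → ℝ} (hp : IsStarAlgebraCStarNorm p)
    (hq0 : ∀ x, 0 ≤ q x) (hq : ∀ x y, q (x * y) ≤ q x * q y) {S : Set R}
    (hS : ∀ x ∈ S, ∀ y ∈ S, x * y ∈ S) {C : ℝ} (hC0 : 0 ≤ C) (hC : ∀ x ∈ S, p x ≤ C * q x) {h : R}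
    (hh : h ∈ S) (hsa : IsSelfAdjoint h) : p h ≤ q h := by
  refine le_of_forall_pow_two_pow_le (C := C) (hq0 _) fun n => ?_
  rw [← hp.map_iterate_sq hsa]
  exact (hC _ (iterate_sq_mem hS hh n)).trans
    (mul_le_mul_of_nonneg_left (apply_iterate_sq_le hq0 hq h n) hC0)

end

/-- A seminorm on a unital C⋆-algebra which is bounded on unitaries is bounded, because every
element is a combination of four unitaries. -/
lemma le_two_mul_norm_of_unitary {A : Type*} [CStarAlgebra A] {f : A → ℝ} {r : ℝ}
    (hadd : ∀ x y, f (x + y) ≤ f x + f y) (hsmul : ∀ (c : ℂ) (x), f (c • x) = ‖c‖ * f x)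
    (hf : ∀ u ∈ unitary A, f u ≤ r) (a : A) : f a ≤ 2 * ‖a‖ * r := by
  obtain ⟨u, c, hx, hc⟩ := CStarAlgebra.exists_sum_four_unitary a
  have hr : 0 ≤ r := by
    have h0 : f 0 = 0 := by simpa using hsmul 0 0
    have h1 := hadd 1 (-1)
    have h2 := hsmul (-1) 1
    rw [add_neg_cancel, h0] at h1
    have h3 := hf 1 (one_mem _)
    simp at h2
    linarith
  have h (i) : f (c i • (u i : A)) ≤ ‖a‖ / 2 * r := by
    rw [hsmul]
    exact (mul_le_mul_of_nonneg_left (hf _ (u i).2) (norm_nonneg _)).trans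
      (mul_le_mul_of_nonneg_right (hc i) hr)
  calc f a ≤ f (c 0 • (u 0 : A)) + f (c 1 • (u 1 : A)) + f (c 2 • (u 2 : A))
        + f (c 3 • (u 3 : A)) := by
        conv_lhs => rw [hx, Fin.sum_univ_four]
        exact (hadd _ _).trans (add_le_add_left ((hadd _ _).trans
          (add_le_add_left (hadd _ _) _)) _)
    _ ≤ ‖a‖ / 2 * r + ‖a‖ / 2 * r + ‖a‖ / 2 * r + ‖a‖ / 2 * r := by gcongr <;> exact h _
    _ = 2 * ‖a‖ * r := by ring

section

variable {B : Type*} [NonUnitalCStarAlgebra B]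

lemma isStarAlgebraCStarNorm_norm : IsStarAlgebraCStarNorm (fun b : B => ‖b‖) where
  add_le := norm_add_le
  smul := norm_smul
  eq_zero _ := norm_eq_zero.1
  mul_le := norm_mul_le
  star_mul_self x := by rw [CStarRing.norm_star_mul_self, sq]

/-- A C⋆-norm on a C⋆-algebra is at most the given norm. The unitaries of the unitization preserve
`p` under left multiplication, so `p (a * b) ≤ 2 * ‖a‖ * p b`; taking `a = star b` gives
`p b ≤ 2 * ‖b‖`, and the factor is removed by `IsStarAlgebraCStarNorm.le_of_le_mul`. -/
lemma IsStarAlgebraCStarNorm.le_norm {p : B → ℝ} (hp : IsStarAlgebraCStarNorm p) (b : B) :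
    p b ≤ ‖b‖ := by
  have hmul (b : B) (a : Unitization ℂ B) : p (a.fst • b + a.snd * b) ≤ 2 * ‖a‖ * p b := by
    refine le_two_mul_norm_of_unitary (f := fun a : Unitization ℂ B => p (a.fst • b + a.snd * b))
      (fun x y => ?_) (fun c x => ?_) (fun u hu => le_of_eq ?_) a
    · refine le_trans (le_of_eq ?_) (hp.add_le _ _)
      simp only [Unitization.fst_add, Unitization.snd_add, add_smul, add_mul]
      congr 1; abel
    · rw [← hp.smul]
      simp [smul_add, mul_smul, smul_mul_assoc]
    · refine hp.map_eq_of_star_mul_self_eq ?_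
      have hinr : (↑(u.fst • b + u.snd * b) : Unitization ℂ B) = u * (b : Unitization ℂ B) := by
        ext <;> simp
      apply Unitization.inr_injective (R := ℂ)
      rw [Unitization.inr_mul, Unitization.inr_star, hinr, star_mul, mul_assoc,
        ← mul_assoc (star u), Unitary.star_mul_self_of_mem hu, one_mul, Unitization.inr_mul,
        Unitization.inr_star]
  have hC (x : B) : p x ≤ 2 * ‖x‖ := by
    rcases (hp.nonneg x).eq_or_lt with h | h
    · rw [← h]; positivity
    · have h1 := hmul x (star x : B)
      simp only [Unitization.fst_inr, zero_smul, Unitization.snd_inr, zero_add, hp.star_mul_self,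
        Unitization.norm_inr, norm_star, sq] at h1
      exact le_of_mul_le_mul_right h1 h
  have key := hp.le_of_le_mul norm_nonneg norm_mul_le (S := Set.univ) (fun _ _ _ _ => trivial)
    zero_le_two (fun x _ => hC x) (Set.mem_univ _) (.star_mul_self b)
  rw [hp.star_mul_self, CStarRing.norm_star_mul_self, ← sq] at key
  exact (sq_le_sq₀ (hp.nonneg _) (norm_nonneg _)).1 key

/-- A C⋆-algebra has only one C⋆-norm. -/
lemma IsStarAlgebraCStarNorm.eq_norm {p : B → ℝ} (hp : IsStarAlgebraCStarNorm p) (b : B) :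
    p b = ‖b‖ := by
  let _ := CStarAlgebra.spectralOrder B
  let _ := CStarAlgebra.spectralOrderedRing B
  suffices key : ∀ h : B, 0 ≤ h → ‖h‖ ≤ p h by
    refine le_antisymm (hp.le_norm b) ?_
    have := key _ (star_mul_self_nonneg b)
    rw [hp.star_mul_self, CStarRing.norm_star_mul_self, ← sq] at this
    exact (sq_le_sq₀ (norm_nonneg _) (hp.nonneg _)).1 this
  intro h hh
  by_contra! hlt
  obtain ⟨m, hm1, hm2⟩ := exists_between hlt
  have hm : 0 < m := (hp.nonneg h).trans_lt hm1
  -- `f` is supported where the identity function has the inverse `g`, so `g(h) h f(h) = f(h)`.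
  let f : ℝ → ℝ := fun t => max 0 (t - m)
  let g : ℝ → ℝ := fun t => t / max t m ^ 2
  have hmax (t : ℝ) : 0 < max t m := lt_max_of_lt_right hm
  have hf : Continuous f := by fun_prop
  have hg : Continuous g := by
    refine continuous_id.div (by fun_prop) fun t => ?_
    exact pow_ne_zero _ (hmax t).ne'
  have hf0 : f 0 = 0 := by simp [f, hm.le]
  have hg0 : g 0 = 0 := by simp [g]
  have hsa : IsSelfAdjoint h := .of_nonneg hh
  have hσ : ∀ t ∈ quasispectrum ℝ h, 0 ≤ t := fun t ht => quasispectrum_nonneg_of_nonneg h hh t ht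
  have hgf : cfcₙ f h = cfcₙ g h * (h * cfcₙ f h) := by
    have e : h * cfcₙ f h = cfcₙ (fun t => t * f t) h := by
      rw [cfcₙ_mul (fun t : ℝ => t) f h (by fun_prop) rfl hf.continuousOn hf0, cfcₙ_id' ℝ h hsa]
    rw [e, ← cfcₙ_mul g _ h hg.continuousOn hg0 (by fun_prop) (by simp)]
    refine cfcₙ_congr fun t _ => ?_
    rcases le_total t m with htm | htm
    · simp [f, htm]
    · have : t ≠ 0 := (hm.trans_le htm).ne'
      simp only [g, max_eq_left htm]
      field_simp
  have hgn : ‖cfcₙ g h‖ ≤ 1 / m := by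
    refine norm_cfcₙ_le fun t ht => ?_
    have := hσ t ht
    rw [Real.norm_of_nonneg (by positivity)]
    simp only [g]
    rw [div_le_div_iff₀ (pow_pos (hmax t) 2) hm, one_mul, sq]
    exact mul_le_mul (le_max_left _ _) (le_max_right _ _) hm.le (hmax t).le
  have hfp : p (cfcₙ f h) = 0 := by
    by_contra hne
    have hpos : 0 < p (cfcₙ f h) := (hp.nonneg _).lt_of_ne' hne
    have : p (cfcₙ f h) ≤ 1 / m * (p h * p (cfcₙ f h)) := by
      conv_lhs => rw [hgf]
      refine (hp.mul_le _ _).trans (mul_le_mul ((hp.le_norm _).trans hgn) (hp.mul_le _ _)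
        (hp.nonneg _) (by positivity))
    rw [← mul_assoc] at this
    have h1 : 1 / m * p h < 1 := by rw [one_div, inv_mul_lt_iff₀ hm]; simpa
    nlinarith
  have hf' := hp.eq_zero _ hfp
  refine hm2.not_ge ?_
  rw [show ‖h‖ = ‖cfcₙ (fun t : ℝ => t) h‖ by rw [cfcₙ_id' ℝ h hsa]]
  refine norm_cfcₙ_le fun t ht => ?_
  rw [Real.norm_of_nonneg (hσ t ht)]
  have h2 := norm_apply_le_norm_cfcₙ f h ht hf.continuousOn hf0 hsa
  rw [hf', norm_zero, Real.norm_of_nonneg (le_max_left _ _)] at h2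
  linarith [le_max_right 0 (t - m)]

end

/-! ### Algebras graded by a vector space over the field with two elements -/

/-- A finitely generated vector space over a finite field is finite. -/
lemma exists_finset_superset_add_mem {V : Type*} [AddCommGroup V] [Module (ZMod 2) V]
    (t : Finset V) : ∃ s : Finset V, t ⊆ s ∧ ∀ u ∈ s, ∀ v ∈ s, u + v ∈ s := by
  let K := Submodule.span (ZMod 2) (t : Set V)
  have : Finite K := Module.finite_of_finite (ZMod 2)
  have hK : (K : Set V).Finite := Set.toFinite _
  refine ⟨hK.toFinset, fun v hv => ?_, fun u hu v hv => ?_⟩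
  · simpa using Submodule.subset_span (s := (t : Set V)) hv
  · simp only [Set.Finite.mem_toFinset, SetLike.mem_coe] at hu hv ⊢
    exact K.add_mem hu hv

/-- The sums of homogeneous elements with degrees in `s`. -/
def gradedSum {V M : Type*} [AddCommMonoid M] [Module ℂ M] (R : V → Submodule ℂ M)
    (s : Finset V) : Set M :=
  {x | ∃ f : V → M, (∀ v, f v ∈ R v) ∧ x = ∑ v ∈ s, f v}

lemma star_mem_gradedSum {V M : Type*} [NonUnitalRing M] [StarRing M] [Module ℂ M]
    {R : V → Submodule ℂ M} (hstar : ∀ v, ∀ x ∈ R v, star x ∈ R v) {s : Finset V} {x : M}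
    (hx : x ∈ gradedSum R s) : star x ∈ gradedSum R s := by
  obtain ⟨f, hf, rfl⟩ := hx
  exact ⟨fun v => star (f v), fun v => hstar v _ (hf v), star_sum _ _⟩

section

variable {V : Type*} [AddCommGroup V] [Module (ZMod 2) V] {M : Type*} [NonUnitalRing M]
  [Module ℂ M] {R : V → Submodule ℂ M}

lemma mul_mem_gradedSum (hmul : ∀ u v, ∀ x ∈ R u, ∀ y ∈ R v, x * y ∈ R (u + v)) {s : Finset V}
    (hs : ∀ u ∈ s, ∀ v ∈ s, u + v ∈ s) {x y : M} (hx : x ∈ gradedSum R s)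
    (hy : y ∈ gradedSum R s) : x * y ∈ gradedSum R s := by
  obtain ⟨f, hf, rfl⟩ := hx
  obtain ⟨g, hg, rfl⟩ := hy
  have hadd (u v : V) : u + (u + v) = v := by
    rw [← add_assoc, ZModModule.add_self, zero_add]
  refine ⟨fun k => ∑ u ∈ s, f u * g (u + k), fun k => Submodule.sum_mem _ fun u _ => ?_, ?_⟩
  · simpa only [hadd] using hmul u (u + k) _ (hf u) _ (hg _)
  · rw [Finset.sum_mul_sum, Finset.sum_comm (s := s) (t := s) (f := fun k u => f u * g (u + k))]
    refine Finset.sum_congr rfl fun u hu => ?_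
    exact Finset.sum_nbij' (fun v => u + v) (fun v => u + v) (fun v hv => hs u hu v hv)
      (fun v hv => hs u hu v hv) (fun v _ => hadd u v) (fun v _ => hadd u v)
      (fun v _ => by rw [hadd])

lemma exists_mem_gradedSum {x : M} (hx : x ∈ ⨆ v, R v) :
    ∃ s : Finset V, (∀ u ∈ s, ∀ v ∈ s, u + v ∈ s) ∧ x ∈ gradedSum R s := by
  classical
  obtain ⟨f, hf, rfl⟩ := (Submodule.mem_iSup_iff_exists_finsupp R x).1 hx
  obtain ⟨s, hts, hs⟩ := exists_finset_superset_add_mem f.support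
  refine ⟨s, hs, f, hf, ?_⟩
  exact Finsupp.sum_of_support_subset _ hts _ fun _ _ => rfl

/-- On a graded ⋆-algebra, a C⋆-norm is dominated by every submultiplicative function that dominates
it on homogeneous components. The constant of comparison on a finite subgroup of degrees is its
order, and `IsStarAlgebraCStarNorm.le_of_le_mul` removes it. -/
lemma IsStarAlgebraCStarNorm.le_of_forall_component [StarRing M] {p q : M → ℝ}
    (hp : IsStarAlgebraCStarNorm p)
    (hq0 : ∀ x, 0 ≤ q x) (hq : ∀ x y, q (x * y) ≤ q x * q y)
    (hmul : ∀ u v, ∀ x ∈ R u, ∀ y ∈ R v, x * y ∈ R (u + v))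
    (hstar : ∀ v, ∀ x ∈ R v, star x ∈ R v)
    (hpq : ∀ (s : Finset V) (f : V → M), (∀ v, f v ∈ R v) → ∀ k ∈ s, p (f k) ≤ q (∑ v ∈ s, f v))
    {x : M} (hx : x ∈ ⨆ v, R v) : p (star x * x) ≤ q (star x * x) := by
  obtain ⟨s, hs, hxs⟩ := exists_mem_gradedSum hx
  refine hp.le_of_le_mul hq0 hq (S := gradedSum R s) (C := s.card)
    (fun x hx y hy => mul_mem_gradedSum hmul hs hx hy) (by positivity) ?_
    (mul_mem_gradedSum hmul hs (star_mem_gradedSum hstar hxs) hxs) (.star_mul_self x)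
  rintro y ⟨f, hf, rfl⟩
  calc p (∑ v ∈ s, f v) ≤ ∑ v ∈ s, p (f v) := hp.sum_le _ _
    _ ≤ ∑ _v ∈ s, q (∑ v ∈ s, f v) := Finset.sum_le_sum fun k hk => hpq s f hf k hk
    _ = s.card * q (∑ v ∈ s, f v) := by simp

end

/-- Extraction of a component by averaging. If linear operators `T l` act on the `m v` by signs
which separate the indices, then a property which is inherited by the averages `(x ± T l x) / 2`
passes from a finite sum of the `m v` to its summands. -/
lemma component_of_sum {V M : Type*} [AddCommGroup M] [Module ℂ M] {P : M → Prop}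
    {T : V → M →ₗ[ℂ] M} {β : V → V → ℂ} {m : V → M} (hT : ∀ l v, T l (m v) = β l v • m v)
    (hβ : ∀ u v, β u v = 1 ∨ β u v = -1) (hsep : ∀ u v, u ≠ v → ∃ l, β l u ≠ β l v)
    (hP : ∀ l (c : ℂ), c = 1 ∨ c = -1 → ∀ x, P x → P ((1 / 2 : ℂ) • (x + c • T l x)))
    (s : Finset V) {k : V} (hk : k ∈ s) (hs : P (∑ v ∈ s, m v)) : P (m k) := by
  classical
  induction s using Finset.strongInduction with
  | H s ih =>
    -- Averaging with an `l` that separates `v` from `k` keeps the `k` term, not the `v` term.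
    by_cases h : ∃ v ∈ s, v ≠ k
    · obtain ⟨v, hv, hvk⟩ := h
      obtain ⟨l, hl⟩ := hsep v k hvk
      refine ih (s.filter fun u => β l u = β l k) ?_ (by simp [hk]) ?_
      · exact Finset.filter_ssubset.2 ⟨v, hv, hl⟩
      · convert hP l (β l k) (hβ l k) _ hs using 1
        rw [map_sum, Finset.smul_sum, ← Finset.sum_add_distrib, Finset.smul_sum,
          Finset.sum_filter]
        refine Finset.sum_congr rfl fun u _ => ?_
        rw [hT]
        rcases hβ l u with h1 | h1 <;> rcases hβ l k with h2 | h2 <;>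
          simp only [h1, h2] <;> norm_num <;> module
    · push Not at h
      have : s = {k} := Finset.eq_singleton_iff_unique_mem.2 ⟨hk, h⟩
      simpa [this] using hs

/-! ### Pauli systems -/

/-- A family of unitaries indexed by a vector space over the field with two elements, which is
multiplicative up to scalars, in which any two elements `w u`, `w v` commute up to the sign `β u v`,
these signs separate the indices, and whose linear span is dense. -/
structure IsPauliSystem {V : Type*} [AddCommGroup V] {A : Type*} [CStarAlgebra A] (w : V → A)
    (β : V → V → ℂ) : Prop where
  unitary : ∀ v, w v ∈ unitary A
  mul_eq : ∀ u v, ∃ c : ℂ, w u * w v = c • w (u + v)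
  star_eq : ∀ v, ∃ c : ℂ, star (w v) = c • w v
  comm : ∀ u v, w u * w v = β u v • (w v * w u)
  sign : ∀ u v, β u v = 1 ∨ β u v = -1
  separates : ∀ u v, u ≠ v → ∃ l, β l u ≠ β l v
  dense : Dense (Submodule.span ℂ (Set.range w) : Set A)

/-- The map `x ↦ a * x * star a`. -/
noncomputable def conjLinear {A : Type*} [CStarAlgebra A] (a : A) : A →ₗ[ℂ] A :=
  LinearMap.mulLeft ℂ a ∘ₗ LinearMap.mulRight ℂ (star a)

lemma conjLinear_apply {A : Type*} [CStarAlgebra A] (a x : A) :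
    conjLinear a x = a * (x * star a) := rfl

namespace IsPauliSystem

variable {V : Type*} [AddCommGroup V] {A : Type*} [CStarAlgebra A] {w : V → A} {β : V → V → ℂ}

lemma conjLinear_apply_self (hw : IsPauliSystem w β) (l v : V) :
    conjLinear (w l) (w v) = β l v • w v := by
  rw [conjLinear_apply, ← mul_assoc, hw.comm, smul_mul_assoc, mul_assoc,
    Unitary.mul_star_self_of_mem (hw.unitary l), mul_one]

lemma norm_apply [Nontrivial A] (hw : IsPauliSystem w β) (v : V) : ‖w v‖ = 1 :=
  CStarRing.norm_of_mem_unitary (hw.unitary v)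

end IsPauliSystem

/-! ### Simplicity -/

/-- A two-sided ring ideal of a unital C⋆-algebra, as a complex subspace. -/
def TwoSidedIdeal.toComplexSubmodule {A : Type*} [CStarAlgebra A] (I : TwoSidedIdeal A) :
    Submodule ℂ A where
  carrier := I
  add_mem' := I.add_mem
  zero_mem' := I.zero_mem
  smul_mem' c x hx := by
    have := I.mul_mem_left (c • (1 : A)) x hx
    rwa [smul_mul_assoc, one_mul] at this

lemma TwoSidedIdeal.norm_mk_mul_le {A : Type*} [CStarAlgebra A] (I : TwoSidedIdeal A) (x y : A) :
    ‖I.toComplexSubmodule.mkQ (x * y)‖ ≤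
      ‖I.toComplexSubmodule.mkQ x‖ * ‖I.toComplexSubmodule.mkQ y‖ := by
  set S := I.toComplexSubmodule
  have key : ∀ ε > 0, ‖S.mkQ (x * y)‖ ≤ (‖S.mkQ x‖ + ε) * (‖S.mkQ y‖ + ε) := by
    intro ε hε
    obtain ⟨m, hm, hmε⟩ := Submodule.Quotient.norm_mk_lt (S.mkQ x) hε
    obtain ⟨n, hn, hnε⟩ := Submodule.Quotient.norm_mk_lt (S.mkQ y) hε
    have hmn : S.mkQ (x * y) = Submodule.Quotient.mk (m * n) := by
      refine (Submodule.Quotient.eq S).2 ?_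
      have h1 : x - m ∈ I := (Submodule.Quotient.eq S).1 hm.symm
      have h2 : y - n ∈ I := (Submodule.Quotient.eq S).1 hn.symm
      have : x * y - m * n = (x - m) * y + m * (y - n) := by noncomm_ring
      rw [this]
      exact I.add_mem (I.mul_mem_right _ _ h1) (I.mul_mem_left _ _ h2)
    rw [hmn]
    exact (Submodule.Quotient.norm_mk_le S _).trans ((norm_mul_le _ _).trans (by gcongr))
  have hlim : Filter.Tendsto (fun ε : ℝ => (‖S.mkQ x‖ + ε) * (‖S.mkQ y‖ + ε))
      (nhdsWithin 0 (Set.Ioi 0)) (nhds ((‖S.mkQ x‖ + 0) * (‖S.mkQ y‖ + 0))) :=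
    (Continuous.tendsto (by fun_prop) 0).mono_left nhdsWithin_le_nhds
  simp only [add_zero] at hlim
  exact ge_of_tendsto hlim (Filter.eventually_of_mem self_mem_nhdsWithin key)

/-- The quotient norm by a proper ideal is at least one at the unit, since elements near the unit
are invertible. -/
lemma TwoSidedIdeal.one_le_norm_mk_one {A : Type*} [CStarAlgebra A] {I : TwoSidedIdeal A}
    (hI : (1 : A) ∉ I) : 1 ≤ ‖I.toComplexSubmodule.mkQ 1‖ := by
  by_contra! hlt
  obtain ⟨m, hm, hm1⟩ := Submodule.Quotient.norm_mk_lt (I.toComplexSubmodule.mkQ 1)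
    (sub_pos.2 hlt)
  rw [add_sub_cancel] at hm1
  have h1 : 1 - m ∈ I := (Submodule.Quotient.eq I.toComplexSubmodule).1 hm.symm
  obtain ⟨b, hb⟩ := (isUnit_one_sub_of_norm_lt_one hm1).exists_left_inv
  exact hI (hb ▸ I.mul_mem_left b _ h1)

namespace IsPauliSystem

variable {V : Type*} [AddCommGroup V] [Module (ZMod 2) V] {A : Type*} [CStarAlgebra A] {w : V → A}
  {β : V → V → ℂ}

/-- The quotient norm by a proper closed ideal satisfies the hypotheses of
`IsStarAlgebraCStarNorm.le_of_forall_component`, so it is the norm. -/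
theorem isSimpleCStarAlgebra [Nontrivial A] (hw : IsPauliSystem w β) : IsSimpleCStarAlgebra A := by
  refine ⟨inferInstance, fun I hI => ?_⟩
  by_cases h1 : (1 : A) ∈ I
  · right
    rw [eq_top_iff]
    exact fun x _ => by simpa using I.mul_mem_left x 1 h1
  left
  set S := I.toComplexSubmodule
  let q : A → ℝ := fun x => ‖S.mkQ x‖
  have hq0 : ∀ x, 0 ≤ q x := fun x => norm_nonneg _
  have hqmul : ∀ x y, q (x * y) ≤ q x * q y := I.norm_mk_mul_le
  have hqle : ∀ x, q x ≤ ‖x‖ := fun x => Submodule.Quotient.norm_mk_le S x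
  have hqadd (x y : A) : q (x + y) ≤ q x + q y := by
    simp only [q, map_add]; exact norm_add_le _ _
  have hqsmul (c : ℂ) (x : A) : q (c • x) = ‖c‖ * q x := by
    simp only [q, map_smul]; exact norm_smul _ _
  have hq1 : 1 ≤ q 1 := TwoSidedIdeal.one_le_norm_mk_one h1
  have hqw (v : V) : 1 ≤ q (w v) := by
    have h := hqmul (star (w v)) (w v)
    rw [Unitary.star_mul_self_of_mem (hw.unitary v)] at h
    have h2 := hqle (star (w v))
    rw [norm_star, hw.norm_apply] at h2
    exact hq1.trans (h.trans (mul_le_of_le_one_left (hq0 _) h2))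
  let R : V → Submodule ℂ A := fun v => Submodule.span ℂ {w v}
  have hR : (⨆ v, R v) = Submodule.span ℂ (Set.range w) := by
    rw [← Submodule.span_iUnion, Set.iUnion_singleton_eq_range]
  have key : ∀ x ∈ ⨆ v, R v, ‖star x * x‖ ≤ q (star x * x) := by
    intro x hx
    refine isStarAlgebraCStarNorm_norm.le_of_forall_component hq0 hqmul (R := R) ?_ ?_ ?_ hx
    · intro u v x hx y hy
      obtain ⟨a, rfl⟩ := Submodule.mem_span_singleton.1 hx
      obtain ⟨b, rfl⟩ := Submodule.mem_span_singleton.1 hy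
      obtain ⟨c, hc⟩ := hw.mul_eq u v
      rw [smul_mul_smul_comm, hc, smul_smul]
      exact Submodule.smul_mem _ _ (Submodule.mem_span_singleton_self _)
    · intro v x hx
      obtain ⟨a, rfl⟩ := Submodule.mem_span_singleton.1 hx
      obtain ⟨c, hc⟩ := hw.star_eq v
      rw [star_smul, hc, smul_smul]
      exact Submodule.smul_mem _ _ (Submodule.mem_span_singleton_self _)
    · intro s f hf k hk
      have hfw (v : V) : ∃ c : ℂ, c • w v = f v := Submodule.mem_span_singleton.1 (hf v)
      -- Conjugation does not increase `q`, so averaging does not either.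
      have h : q (f k) ≤ q (∑ v ∈ s, f v) := by
        refine component_of_sum (P := fun x => q x ≤ q (∑ v ∈ s, f v))
          (T := fun l => conjLinear (w l)) (fun l v => ?_) hw.sign hw.separates
          (fun l c hc x hx => ?_) s hk le_rfl
        · obtain ⟨c, hc⟩ := hfw v
          rw [← hc, map_smul, hw.conjLinear_apply_self, smul_comm]
        · have hT : q (conjLinear (w l) x) ≤ q x := by
            rw [conjLinear_apply]
            have hl : q (w l) ≤ 1 := (hqle _).trans_eq (hw.norm_apply l)
            have hl' : q (star (w l)) ≤ 1 := (hqle _).trans_eq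
              ((norm_star _).trans (hw.norm_apply l))
            exact (hqmul _ _).trans ((mul_le_of_le_one_left (hq0 _) hl).trans
              ((hqmul _ _).trans (mul_le_of_le_one_right (hq0 _) hl')))
          have hc' : ‖c‖ = 1 := by rcases hc with rfl | rfl <;> simp
          have := hqadd x (c • conjLinear (w l) x)
          rw [hqsmul, hc', one_mul] at this
          rw [hqsmul]
          norm_num
          linarith
      refine le_trans ?_ h
      obtain ⟨c, hc⟩ := hfw k
      rw [← hc, hqsmul, norm_smul, hw.norm_apply]
      exact mul_le_mul_of_nonneg_left (hqw k) (norm_nonneg _)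
  have key2 : ∀ x, ‖x‖ ≤ q x := by
    have hq : Continuous q :=
      continuous_norm.comp (continuous_quot_mk : Continuous (fun x : A => (S.mkQ x : A ⧸ S)))
    refine fun x => hw.dense.induction (P := fun x => ‖x‖ ≤ q x) (fun x hx => ?_)
      (isClosed_le continuous_norm hq) x
    rw [SetLike.mem_coe, ← hR] at hx
    rcases eq_or_ne x 0 with rfl | h0
    · simpa using hq0 0
    have h := (key x hx).trans ((hqmul _ _).trans
      (mul_le_mul_of_nonneg_right ((hqle _).trans_eq (norm_star x)) (hq0 x)))
    rw [CStarRing.norm_star_mul_self] at h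
    exact le_of_mul_le_mul_left h (norm_pos_iff.2 h0)
  rw [eq_bot_iff]
  intro x hx
  have : q x = 0 := by
    have h0 : S.mkQ x = 0 := (Submodule.Quotient.mk_eq_zero S).2 hx
    simp only [q, h0, norm_zero]
  have h0 : x = 0 := norm_le_zero_iff.1 ((key2 x).trans_eq this)
  simp [h0]

end IsPauliSystem

/-! ### Nuclearity -/

section

variable {A B : Type*} [CStarAlgebra A] [NonUnitalCStarAlgebra B]

/-- The involution `star (a ⊗ b) = star a ⊗ star b` is antimultiplicative. -/
noncomputable instance : StarRing (A ⊗[ℂ] B) where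
  star_add := star_add
  star_mul x y := by
    induction x with
    | zero => simp
    | add x₁ x₂ h₁ h₂ => simp [add_mul, mul_add, h₁, h₂]
    | tmul a b =>
      induction y with
      | zero => simp
      | add y₁ y₂ h₁ h₂ => simp [add_mul, mul_add, h₁, h₂]
      | tmul c d => simp

/-- Left multiplication by `a ⊗ 1`, available although `B` need not have a unit. -/
noncomputable def leftMul (a : A) : A ⊗[ℂ] B →ₗ[ℂ] A ⊗[ℂ] B :=
  (LinearMap.mulLeft ℂ a).rTensor B

lemma leftMul_tmul (a c : A) (b : B) : leftMul a (c ⊗ₜ[ℂ] b) = (a * c) ⊗ₜ[ℂ] b := rfl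

lemma star_leftMul_mul_leftMul {u : A} (hu : u ∈ unitary A) (x y : A ⊗[ℂ] B) :
    star (leftMul u x) * leftMul u y = star x * y := by
  induction x with
  | zero => simp
  | add x₁ x₂ h₁ h₂ => simp [add_mul, h₁, h₂]
  | tmul a b =>
    induction y with
    | zero => simp
    | add y₁ y₂ h₁ h₂ => simp [mul_add, h₁, h₂]
    | tmul c d =>
      simp only [leftMul_tmul, TensorProduct.star_tmul, Algebra.TensorProduct.tmul_mul_tmul,
        star_mul]
      rw [mul_assoc, ← mul_assoc (star u), Unitary.star_mul_self_of_mem hu, one_mul]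

lemma rTensor_conjLinear (a : A) (x : A ⊗[ℂ] B) :
    (conjLinear a).rTensor B x = leftMul a (star (leftMul a (star x))) := by
  induction x with
  | zero => simp
  | add x₁ x₂ h₁ h₂ => simp [h₁, h₂]
  | tmul c b => simp [leftMul_tmul, conjLinear_apply]

variable {p : A ⊗[ℂ] B → ℝ}

lemma IsCStarNorm.isStarAlgebraCStarNorm (hp : IsCStarNorm p) : IsStarAlgebraCStarNorm p :=
  ⟨hp.add_le, hp.smul, hp.eq_zero, hp.mul_le, hp.star_mul_self⟩

namespace IsStarAlgebraCStarNorm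

lemma map_leftMul (hp : IsStarAlgebraCStarNorm p) {u : A} (hu : u ∈ unitary A) (x : A ⊗[ℂ] B) :
    p (leftMul u x) = p x :=
  hp.map_eq_of_star_mul_self_eq (star_leftMul_mul_leftMul hu x x)

lemma map_rTensor_conjLinear (hp : IsStarAlgebraCStarNorm p) {u : A} (hu : u ∈ unitary A)
    (x : A ⊗[ℂ] B) : p ((conjLinear u).rTensor B x) = p x := by
  rw [rTensor_conjLinear, hp.map_leftMul hu, hp.map_star, hp.map_leftMul hu, hp.map_star]

/-- The norm is unchanged when a unitary first factor is replaced by `1`, and `b ↦ p (1 ⊗ b)` is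
a C⋆-norm on `B`. -/
lemma map_unitary_tmul [Nontrivial A] (hp : IsStarAlgebraCStarNorm p) {u : A} (hu : u ∈ unitary A)
    (b : B) : p (u ⊗ₜ b) = ‖b‖ := by
  have h1 : p (u ⊗ₜ b) = p (1 ⊗ₜ b) := by
    rw [← hp.map_leftMul hu (1 ⊗ₜ b), leftMul_tmul, mul_one]
  rw [h1]
  have hB : IsStarAlgebraCStarNorm fun b : B => p ((1 : A) ⊗ₜ b) :=
    { add_le := fun x y => by rw [TensorProduct.tmul_add]; exact hp.add_le _ _
      smul := fun c x => by rw [TensorProduct.tmul_smul]; exact hp.smul _ _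
      eq_zero := fun x hx => by
        obtain ⟨f, hf⟩ := SeparatingDual.exists_ne_zero (R := ℂ) (one_ne_zero (α := A))
        have h := congrArg (fun z => TensorProduct.lid ℂ B ((f : A →ₗ[ℂ] ℂ).rTensor B z))
          (hp.eq_zero _ hx)
        simpa [hf] using h
      mul_le := fun x y => by simpa using hp.mul_le ((1 : A) ⊗ₜ x) (1 ⊗ₜ y)
      star_mul_self := fun x => by simpa using hp.star_mul_self ((1 : A) ⊗ₜ x) }
  exact hB.eq_norm b

lemma map_tmul_le [Nontrivial A] (hp : IsStarAlgebraCStarNorm p) (a : A) (b : B) :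
    p (a ⊗ₜ b) ≤ 2 * ‖a‖ * ‖b‖ := by
  refine le_two_mul_norm_of_unitary (f := fun a : A => p (a ⊗ₜ b)) (fun x y => ?_)
    (fun c x => ?_) (fun u hu => (hp.map_unitary_tmul hu b).le) a
  · rw [TensorProduct.add_tmul]; exact hp.add_le _ _
  · rw [← TensorProduct.smul_tmul']; exact hp.smul _ _

end IsStarAlgebraCStarNorm

end

namespace IsPauliSystem

variable {V : Type*} [AddCommGroup V] {A : Type*} [CStarAlgebra A] {w : V → A}
  {β : V → V → ℂ} {B : Type*} [NonUnitalCStarAlgebra B]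

/-- The subspace of the elements `w v ⊗ b`, the component of degree `v`. -/
noncomputable def tensorComponent (w : V → A) (B : Type*) [NonUnitalCStarAlgebra B] (v : V) :
    Submodule ℂ (A ⊗[ℂ] B) :=
  LinearMap.range (TensorProduct.mk ℂ A B (w v))

/-- The span of the `w v ⊗ b` is dense, simultaneously for all C⋆-norms. -/
lemma exists_approx [Nontrivial A] (hw : IsPauliSystem w β) (x : A ⊗[ℂ] B) {ε : ℝ} (hε : 0 < ε) :
    ∃ y ∈ ⨆ v, tensorComponent w B v, ∀ p : A ⊗[ℂ] B → ℝ, IsStarAlgebraCStarNorm p →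
      p (x - y) < ε := by
  induction x generalizing ε with
  | zero => exact ⟨0, Submodule.zero_mem _, fun p hp => by simpa [hp.map_zero] using hε⟩
  | add x₁ x₂ h₁ h₂ =>
    obtain ⟨y₁, hy₁, h₁⟩ := h₁ (half_pos hε)
    obtain ⟨y₂, hy₂, h₂⟩ := h₂ (half_pos hε)
    refine ⟨y₁ + y₂, Submodule.add_mem _ hy₁ hy₂, fun p hp => ?_⟩
    rw [add_sub_add_comm]
    linarith [hp.add_le (x₁ - y₁) (x₂ - y₂), h₁ p hp, h₂ p hp]
  | tmul a b =>
    obtain ⟨c, hc, hac⟩ := hw.dense.exists_dist_lt a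
      (show 0 < ε / (2 * (‖b‖ + 1)) by positivity)
    refine ⟨c ⊗ₜ b, ?_, fun p hp => ?_⟩
    · clear hac
      induction hc using Submodule.span_induction with
      | mem x hx =>
        obtain ⟨v, rfl⟩ := hx
        exact Submodule.mem_iSup_of_mem v ⟨b, rfl⟩
      | zero => simp
      | add x y _ _ hx hy => rw [TensorProduct.add_tmul]; exact Submodule.add_mem _ hx hy
      | smul d x _ hx => rw [← TensorProduct.smul_tmul']; exact Submodule.smul_mem _ _ hx
    · rw [← TensorProduct.sub_tmul]
      refine (hp.map_tmul_le _ _).trans_lt ?_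
      rw [dist_eq_norm, lt_div_iff₀ (by positivity)] at hac
      nlinarith [norm_nonneg (a - c), norm_nonneg b]

lemma cstarNorm_le_of_mem [Module (ZMod 2) V] [Nontrivial A] (hw : IsPauliSystem w β)
    {p q : A ⊗[ℂ] B → ℝ} (hp : IsStarAlgebraCStarNorm p) (hq : IsStarAlgebraCStarNorm q)
    {x : A ⊗[ℂ] B} (hx : x ∈ ⨆ v, tensorComponent w B v) : p x ≤ q x := by
  have key : p (star x * x) ≤ q (star x * x) := by
    refine hp.le_of_forall_component hq.nonneg hq.mul_le (R := tensorComponent w B) ?_ ?_ ?_ hx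
    · rintro u v _ ⟨b, rfl⟩ _ ⟨b', rfl⟩
      obtain ⟨c, hc⟩ := hw.mul_eq u v
      refine ⟨c • (b * b'), ?_⟩
      simp only [TensorProduct.mk_apply, Algebra.TensorProduct.tmul_mul_tmul, hc,
        TensorProduct.smul_tmul]
    · rintro v _ ⟨b, rfl⟩
      obtain ⟨c, hc⟩ := hw.star_eq v
      refine ⟨c • star b, ?_⟩
      simp only [TensorProduct.mk_apply, TensorProduct.star_tmul, hc, TensorProduct.smul_tmul]
    · intro s f hf k hk
      -- Conjugation does not increase `q`, so averaging does not either.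
      have h : q (f k) ≤ q (∑ v ∈ s, f v) := by
        refine component_of_sum (P := fun x => q x ≤ q (∑ v ∈ s, f v))
          (T := fun l => (conjLinear (w l)).rTensor B) (fun l v => ?_) hw.sign hw.separates
          (fun l c hc x hx => ?_) s hk le_rfl
        · obtain ⟨b, hb⟩ := hf v
          rw [← hb, TensorProduct.mk_apply, LinearMap.rTensor_tmul, hw.conjLinear_apply_self,
            TensorProduct.smul_tmul']
        · have hc' : ‖c‖ = 1 := by rcases hc with rfl | rfl <;> simp
          have := hq.add_le x (c • (conjLinear (w l)).rTensor B x)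
          rw [hq.smul, hc', one_mul, hq.map_rTensor_conjLinear (hw.unitary l)] at this
          rw [hq.smul]
          norm_num
          linarith
      refine le_trans (le_of_eq ?_) h
      obtain ⟨b, hb⟩ := hf k
      rw [← hb, TensorProduct.mk_apply, hp.map_unitary_tmul (hw.unitary k),
        hq.map_unitary_tmul (hw.unitary k)]
  rw [hp.star_mul_self, hq.star_mul_self] at key
  exact (sq_le_sq₀ (hp.nonneg _) (hq.nonneg _)).1 key

/-- Two C⋆-norms agree on the dense subspace spanned by the elements `w v ⊗ b`. -/
theorem isNuclear {V : Type*} [AddCommGroup V] [Module (ZMod 2) V] {A : Type u} [CStarAlgebra A]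
    [Nontrivial A] {w : V → A} {β : V → V → ℂ} (hw : IsPauliSystem w β) : IsNuclear.{u, v} A := by
  suffices key : ∀ (B : Type v) [NonUnitalCStarAlgebra B] (p q : A ⊗[ℂ] B → ℝ),
      IsStarAlgebraCStarNorm p → IsStarAlgebraCStarNorm q → ∀ x, p x ≤ q x from
    fun B _ p q hp hq => funext fun x => le_antisymm
      (key B p q hp.isStarAlgebraCStarNorm hq.isStarAlgebraCStarNorm x)
      (key B q p hq.isStarAlgebraCStarNorm hp.isStarAlgebraCStarNorm x)
  intro B _ p q hp hq x
  refine le_of_forall_pos_le_add fun ε hε => ?_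
  obtain ⟨y, hy, hxy⟩ := hw.exists_approx x (half_pos hε)
  have h1 := hp.add_le (x - y) y
  have h2 := hq.add_le (-(x - y)) x
  rw [hq.map_neg, neg_sub, sub_add_cancel] at h2
  rw [sub_add_cancel] at h1
  linarith [hxy p hp, hxy q hq, hw.cstarNorm_le_of_mem hp hq hy]

end IsPauliSystem

/-! ### States -/

/-- The degenerate case of the Cauchy–Schwarz inequality for a state. -/
lemma state_mul_eq_zero {A : Type*} [CStarAlgebra A] {φ : StrongDual ℂ A} (hφ : φ ∈ stateSpace A)
    {y : A} (hy : φ (star y * y) = 0) (x : A) : φ (star x * y) = 0 ∧ φ (star y * x) = 0 := by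
  have hpos (t : ℂ) : 0 ≤ φ (star x * x) + t * φ (star x * y) + star t * φ (star y * x) := by
    have h := hφ.1 (x + t • y)
    have e : star (x + t • y) * (x + t • y) = star x * x + t • (star x * y) +
        star t • (star y * x) + (star t * t) • (star y * y) := by
      simp only [star_add, star_smul, add_mul, mul_add, smul_mul_assoc, mul_smul_comm]
      module
    rw [e, map_add, map_add, map_add, map_smul, map_smul, map_smul, hy] at h
    simpa using h
  set a := φ (star x * y)
  set b := φ (star y * x)
  obtain ⟨hx0, hx1⟩ := Complex.nonneg_iff.1 (hφ.1 x)
  set c := φ (star x * x)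
  have him (t : ℂ) : (t * a + star t * b).im = 0 := by
    have h := (Complex.nonneg_iff.1 (hpos t)).2
    simp only [Complex.add_im] at h ⊢
    linarith
  have hre (t : ℂ) : 0 ≤ c.re + (t * a + star t * b).re := by
    have h := (Complex.nonneg_iff.1 (hpos t)).1
    simp only [Complex.add_re] at h ⊢
    linarith
  -- A real-linear function of `t` which is bounded below vanishes.
  have hre0 (t : ℂ) : (t * a + star t * b).re = 0 := by
    by_contra hne
    have h := hre ((-(c.re + 1) / (t * a + star t * b).re : ℝ) * t)
    have e : ((-(c.re + 1) / (t * a + star t * b).re : ℝ) * t) * a +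
        star ((-(c.re + 1) / (t * a + star t * b).re : ℝ) * t) * b =
        ((-(c.re + 1) / (t * a + star t * b).re : ℝ) : ℂ) * (t * a + star t * b) := by
      rw [star_mul', Complex.star_def, Complex.conj_ofReal]
      ring
    rw [e, Complex.re_ofReal_mul, div_mul_cancel₀ _ hne] at h
    linarith
  have h1 : a + b = 0 := by
    apply Complex.ext
    · simpa using hre0 1
    · simpa using him 1
  have h2 : a - b = 0 := by
    apply Complex.ext
    · simpa [sub_eq_add_neg] using him Complex.I
    · have := hre0 Complex.I
      simp at this ⊢
      linarith
  constructor
  · linear_combination (h1 + h2) / 2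
  · linear_combination (h1 - h2) / 2

/-- A self-adjoint unitary of expectation one lies in the multiplicative domain of the state. -/
lemma state_mul_of_apply_eq_one {A : Type*} [CStarAlgebra A] {φ : StrongDual ℂ A}
    (hφ : φ ∈ stateSpace A) (hφ1 : φ 1 = 1) {u : A} (hu : star u = u) (huu : u * u = 1)
    (hφu : φ u = 1) (x : A) : φ (x * u) = φ x ∧ φ (u * x) = φ x := by
  have hy : φ (star (u - 1) * (u - 1)) = 0 := by
    have e : star (u - 1) * (u - 1) = (2 : ℂ) • (1 - u) := by
      rw [star_sub, hu, star_one, mul_sub, sub_mul, sub_mul, huu]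
      simp only [mul_one, one_mul]
      module
    rw [e, map_smul, map_sub, hφ1, hφu, sub_self, smul_zero]
  constructor
  · have h := (state_mul_eq_zero hφ hy (star x)).1
    rwa [star_star, mul_sub, mul_one, map_sub, sub_eq_zero] at h
  · have h := (state_mul_eq_zero hφ hy x).2
    rwa [star_sub, hu, star_one, sub_mul, one_mul, map_sub, sub_eq_zero] at h

lemma norm_apply_le_one {A : Type*} [CStarAlgebra A] {φ : StrongDual ℂ A} (hφ : φ ∈ stateSpace A)
    {u : A} (hu : ‖u‖ ≤ 1) : ‖φ u‖ ≤ 1 := by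
  have h := φ.le_opNorm u
  rw [hφ.2, one_mul] at h
  exact h.trans hu

/-- The value `1` is an extreme point of the closed unit disc. -/
lemma eq_one_of_convex_combination {a b : ℝ} (ha : 0 < a) (hb : 0 < b) (hab : a + b = 1) {z z' : ℂ}
    (hz : ‖z‖ ≤ 1) (hz' : ‖z'‖ ≤ 1) (h : a • z + b • z' = 1) : z = 1 := by
  have h1 : z.re ≤ 1 := (Complex.re_le_norm z).trans hz
  have h2 : z'.re ≤ 1 := (Complex.re_le_norm z').trans hz'
  have h3 : a * z.re + b * z'.re = 1 := by simpa using congrArg Complex.re h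
  have h4 : z.re = 1 := by nlinarith
  have h5 : z.im = 0 := by
    have h6 : z.re * z.re + z.im * z.im ≤ 1 := by
      rw [← Complex.normSq_apply, Complex.normSq_eq_norm_sq]
      exact pow_le_one₀ (norm_nonneg _) hz
    rw [h4] at h6
    nlinarith
  exact Complex.ext h4 h5

/-- A family of states has a limit state, along an ultrafilter finer than `l`, because the dual unit
ball is weak-⋆ compact. -/
lemma exists_state_of_eventually {A : Type*} [CStarAlgebra A] [Nontrivial A] {ι : Type*}
    (l : Filter ι) [l.NeBot] (φ : ι → StrongDual ℂ A) (hφ : ∀ i, φ i ∈ stateSpace A)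
    (hφ1 : ∀ i, φ i 1 = 1) :
    ∃ ψ ∈ stateSpace A, ∀ (a : A) (c : ℂ), (∀ᶠ i in l, φ i a = c) → ψ a = c := by
  let f : ι → WeakDual ℂ A := fun i => StrongDual.toWeakDual (φ i)
  obtain ⟨ψ, hψ, hlim⟩ := (WeakDual.isCompact_closedBall (𝕜 := ℂ) (E := A) 0 1).ultrafilter_le_nhds
    ((Ultrafilter.of l).map f) (by
      rw [Ultrafilter.coe_map, Filter.le_principal_iff, Filter.mem_map]
      refine Filter.univ_mem' fun i => ?_
      simp [f, (hφ i).2])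
  have heval (a : A) : Filter.Tendsto (fun i => φ i a) (Ultrafilter.of l) (nhds (ψ a)) :=
    ((WeakDual.eval_continuous (𝕜 := ℂ) a).tendsto ψ).comp hlim
  have hconst (a : A) (c : ℂ) (h : ∀ᶠ i in l, φ i a = c) : ψ a = c := by
    have hev : ∀ᶠ i in (Ultrafilter.of l : Filter ι), φ i a = c := Ultrafilter.of_le l h
    exact tendsto_nhds_unique (heval a)
      (tendsto_const_nhds.congr' (hev.mono fun i hi => (Eq.symm hi)))
  refine ⟨WeakDual.toStrongDual ψ, ⟨fun a => ?_, ?_⟩, hconst⟩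
  · exact ge_of_tendsto' (heval (star a * a)) fun i => (hφ i).1 a
  · refine le_antisymm (by simpa using hψ) ?_
    have h1 : (WeakDual.toStrongDual ψ) 1 = 1 := hconst 1 1 (.of_forall hφ1)
    have h := (WeakDual.toStrongDual ψ).le_opNorm 1
    rwa [h1, norm_one, CStarRing.norm_one, mul_one] at h

namespace IsPauliSystem

variable {V : Type*} [AddCommGroup V] {A : Type*} [CStarAlgebra A] {w : V → A} {β : V → V → ℂ}

/-- A state that takes the value `1` on `w l` vanishes at every `w v` anticommuting with `w l`. -/
lemma state_apply_eq_zero (hw : IsPauliSystem w β) {φ : StrongDual ℂ A} (hφ : φ ∈ stateSpace A)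
    (hφ1 : φ 1 = 1) {l v : V} (hl : star (w l) = w l) (hφl : φ (w l) = 1) (hlv : β l v = -1) :
    φ (w v) = 0 := by
  have hll : w l * w l = 1 := by
    have h := Unitary.star_mul_self_of_mem (hw.unitary l)
    rwa [hl] at h
  obtain ⟨h1, h2⟩ := state_mul_of_apply_eq_one hφ hφ1 hl hll hφl (w v)
  rw [hw.comm, hlv, map_smul, h1] at h2
  simp only [smul_eq_mul] at h2
  linear_combination (-1 / 2 : ℂ) * h2

/-- A state that takes the value `1` on a maximal commuting family `w l`, `l ∈ L`, is pure: it is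
the only state with these values, and the value `1` is extreme. -/
theorem mem_pureStateSpace [Nontrivial A] (hw : IsPauliSystem w β) {φ : StrongDual ℂ A}
    (hφ : φ ∈ stateSpace A) (hφ1 : φ 1 = 1) {L : Set V} (hL : ∀ l ∈ L, star (w l) = w l)
    (hφL : ∀ l ∈ L, φ (w l) = 1) (hmax : ∀ v, v ∉ L → ∃ l ∈ L, β l v = -1) :
    φ ∈ pureStateSpace A := by
  refine mem_extremePoints_iff_left.2 ⟨hφ, fun ψ hψ ψ' hψ' hφψ => ?_⟩
  obtain ⟨a, b, ha, hb, hab, h⟩ := hφψ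
  have hone (x : A) (hx : ‖x‖ ≤ 1) (hφx : φ x = 1) : ψ x = 1 := by
    refine eq_one_of_convex_combination ha hb hab (norm_apply_le_one hψ hx)
      (norm_apply_le_one hψ' hx) ?_
    rw [← hφx, ← h]
    rfl
  have hψ1 : ψ 1 = 1 := hone 1 CStarRing.norm_one.le hφ1
  have hψL (l) (hl : l ∈ L) : ψ (w l) = 1 := hone _ (hw.norm_apply l).le (hφL l hl)
  refine ContinuousLinearMap.ext_on hw.dense ?_
  rintro _ ⟨v, rfl⟩
  by_cases hv : v ∈ L
  · rw [hφL v hv, hψL v hv]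
  · obtain ⟨l, hl, hlv⟩ := hmax v hv
    rw [hw.state_apply_eq_zero hφ hφ1 (hL l hl) (hφL l hl) hlv,
      hw.state_apply_eq_zero hψ hψ1 (hL l hl) (hψL l hl) hlv]

end IsPauliSystem

/-- If the seminorm `x ↦ φ (star x * x) ^ (1 / 2)` comes from a linear map to a separable Hilbert
space, then no uncountable family is separated for it. -/
lemma no_uncountable_separated {A : Type*} [CStarAlgebra A] {H : Type*} [NormedAddCommGroup H]
    [InnerProductSpace ℂ H] [TopologicalSpace.SeparableSpace H] (T : A →ₗ[ℂ] H)
    {φ : A → ℂ} (hT : ∀ x, φ (star x * x) = (‖T x‖ : ℂ) ^ 2) {ι : Type*} [Uncountable ι]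
    (x : ι → A) : ¬ ∀ i j, i ≠ j → φ (star (x i - x j) * (x i - x j)) = 2 := by
  intro h
  have hd (i j : ι) (hij : i ≠ j) : 1 ≤ dist (T (x i)) (T (x j)) := by
    have h2 := h i j hij
    rw [hT, map_sub] at h2
    have h3 : ‖T (x i) - T (x j)‖ ^ 2 = 2 := by exact_mod_cast h2
    rw [dist_eq_norm]
    nlinarith [norm_nonneg (T (x i) - T (x j))]
  have hc : Countable ι := by
    refine Pairwise.countable_of_isOpen_disjoint (s := fun i => Metric.ball (T (x i)) (1 / 2))
      (fun i j hij => Metric.ball_disjoint_ball ?_) (fun i => Metric.isOpen_ball)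
      fun i => ⟨_, Metric.mem_ball_self (by norm_num)⟩
    linarith [hd i j hij]
  exact not_countable hc

/-! ### The sign pairing -/

/-- The nontrivial character of the group with two elements. -/
def signChar (z : ZMod 2) : ℂ := if z = 0 then 1 else -1

lemma signChar_eq (z : ZMod 2) : signChar z = 1 ∨ signChar z = -1 := by
  unfold signChar; split_ifs <;> simp

lemma signChar_add (z z' : ZMod 2) : signChar (z + z') = signChar z * signChar z' := by
  have h : ∀ z z' : ZMod 2, (z + z' = 0 ↔ (z = 0 ↔ z' = 0)) := by decide
  unfold signChar
  simp only [h]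
  by_cases h1 : z = 0 <;> by_cases h2 : z' = 0 <;> simp [h1, h2]

/-- The pairing of an arbitrary sequence with a finitely supported one, as a sign. -/
noncomputable def signPairing (g : ℕ → ZMod 2) (a : ℕ →₀ ZMod 2) : ℂ :=
  signChar (Finsupp.linearCombination (ZMod 2) g a)

lemma signPairing_eq (g : ℕ → ZMod 2) (a : ℕ →₀ ZMod 2) :
    signPairing g a = 1 ∨ signPairing g a = -1 := signChar_eq _

lemma signPairing_add_right (g : ℕ → ZMod 2) (a b : ℕ →₀ ZMod 2) :
    signPairing g (a + b) = signPairing g a * signPairing g b := by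
  rw [signPairing, map_add, signChar_add]; rfl

lemma signPairing_add_left (g h : ℕ → ZMod 2) (a : ℕ →₀ ZMod 2) :
    signPairing (g + h) a = signPairing g a * signPairing h a := by
  rw [signPairing, signPairing, signPairing, ← signChar_add]
  simp [Finsupp.linearCombination_apply, Finsupp.sum, mul_add, Finset.sum_add_distrib]

lemma signPairing_zero_left (a : ℕ →₀ ZMod 2) : signPairing 0 a = 1 := by
  simp [signPairing, signChar]

lemma signPairing_zero_right (g : ℕ → ZMod 2) : signPairing g 0 = 1 := by
  simp [signPairing, signChar]

lemma signPairing_mul_self (g : ℕ → ZMod 2) (a : ℕ →₀ ZMod 2) :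
    signPairing g a * signPairing g a = 1 := by
  rcases signPairing_eq g a with h | h <;> simp [h]

lemma norm_signPairing (g : ℕ → ZMod 2) (a : ℕ →₀ ZMod 2) : ‖signPairing g a‖ = 1 := by
  rcases signPairing_eq g a with h | h <;> simp [h]

lemma exists_signPairing_left {a : ℕ →₀ ZMod 2} (ha : a ≠ 0) :
    ∃ g, signPairing g a = -1 := by
  obtain ⟨n, hn⟩ := Finsupp.ne_iff.1 ha
  refine ⟨Pi.single n 1, ?_⟩
  have : Finsupp.linearCombination (ZMod 2) (Pi.single n 1) a = a n := by
    rw [Finsupp.linearCombination_apply, Finsupp.sum, Finset.sum_eq_single n]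
    · simp
    · intro m _ hm; simp [hm]
    · intro h; simpa using h
  rw [signPairing, this, signChar, if_neg (by simpa using hn)]

lemma exists_signPairing_right {g : ℕ → ZMod 2} (hg : g ≠ 0) :
    ∃ a, signPairing g a = -1 := by
  obtain ⟨n, hn⟩ := Function.ne_iff.1 hg
  refine ⟨Finsupp.single n 1, ?_⟩
  rw [signPairing, Finsupp.linearCombination_single, one_smul, signChar,
    if_neg (by simpa using hn)]

/-! ### The Pauli operators on a separable Hilbert space -/

/-- The square-summable functions on the countable group of finitely supported sequences. -/
abbrev PauliSpace : Type := lp (fun _ : ℕ →₀ ZMod 2 => ℂ) 2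

/-- The index group: a finitely supported sequence, acting by translation, and an arbitrary
sequence, acting by multiplication with the character it defines. -/
abbrev PauliIndex : Type := (ℕ →₀ ZMod 2) × (ℕ → ZMod 2)

/-- The standard Hilbert basis. -/
noncomputable def pauliBasis : HilbertBasis (ℕ →₀ ZMod 2) ℂ PauliSpace :=
  .ofRepr (.refl ℂ _)

/-- The standard basis, translated and multiplied by signs. -/
noncomputable def pauliVec (v : PauliIndex) (b : ℕ →₀ ZMod 2) : PauliSpace :=
  signPairing v.2 b • pauliBasis (b + v.1)

lemma finsupp_add_add_cancel (a b : ℕ →₀ ZMod 2) : b + a + a = b := by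
  rw [add_assoc, ZModModule.add_self, add_zero]

lemma orthonormal_pauliVec (v : PauliIndex) : Orthonormal ℂ (pauliVec v) := by
  have h := pauliBasis.orthonormal.comp (fun b => b + v.1) (add_left_injective v.1)
  refine ⟨fun b => ?_, fun b c hbc => ?_⟩
  · rw [pauliVec, norm_smul, norm_signPairing, one_mul]
    exact h.1 b
  · simp only [pauliVec, inner_smul_left, inner_smul_right]
    rw [show inner ℂ (pauliBasis (b + v.1)) (pauliBasis (c + v.1)) = 0 from h.2 hbc]
    simp

lemma dense_span_pauliVec (v : PauliIndex) :
    ⊤ ≤ (Submodule.span ℂ (Set.range (pauliVec v))).topologicalClosure := by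
  rw [← pauliBasis.dense_span]
  refine Submodule.topologicalClosure_mono (Submodule.span_le.2 ?_)
  rintro _ ⟨b, rfl⟩
  have : pauliBasis b = signPairing v.2 (b + v.1) • pauliVec v (b + v.1) := by
    rw [pauliVec, smul_smul, signPairing_mul_self, one_smul, finsupp_add_add_cancel]
  rw [this]
  exact Submodule.smul_mem _ _ (Submodule.subset_span ⟨_, rfl⟩)

/-- The Pauli operator of index `(a, g)` maps the basis vector at `b` to that at `a + b`, multiplied
by the sign `signPairing g b`. -/
noncomputable def pauliUnitary (v : PauliIndex) : unitary (PauliSpace →L[ℂ] PauliSpace) :=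
  Unitary.linearIsometryEquiv.symm (pauliBasis.repr.trans
    (HilbertBasis.mk (orthonormal_pauliVec v) (dense_span_pauliVec v)).repr.symm)

/-- The Pauli operators as elements of the algebra of bounded operators. -/
noncomputable def pauliOp (v : PauliIndex) : PauliSpace →L[ℂ] PauliSpace := pauliUnitary v

lemma pauliOp_basis (v : PauliIndex) (b : ℕ →₀ ZMod 2) :
    pauliOp v (pauliBasis b) = signPairing v.2 b • pauliBasis (b + v.1) := by
  classical
  have h : pauliOp v (pauliBasis b) =
      (HilbertBasis.mk (orthonormal_pauliVec v) (dense_span_pauliVec v)).repr.symm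
        (pauliBasis.repr (pauliBasis b)) := rfl
  rw [h, HilbertBasis.repr_self, HilbertBasis.repr_symm_single, HilbertBasis.coe_mk]
  rfl

lemma pauliSpace_clm_ext {S T : PauliSpace →L[ℂ] PauliSpace}
    (h : ∀ b, S (pauliBasis b) = T (pauliBasis b)) : S = T := by
  refine ContinuousLinearMap.ext_on (s := Set.range pauliBasis) ?_ ?_
  · exact Submodule.dense_iff_topologicalClosure_eq_top.2 pauliBasis.dense_span
  · rintro _ ⟨b, rfl⟩
    exact h b

lemma pauliOp_mul (u v : PauliIndex) :
    pauliOp u * pauliOp v = signPairing u.2 v.1 • pauliOp (u + v) := by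
  refine pauliSpace_clm_ext fun b => ?_
  simp only [mul_apply_eq_comp, smul_apply, pauliOp_basis, map_smul,
    smul_smul, Prod.snd_add, Prod.fst_add, signPairing_add_left, signPairing_add_right]
  rw [add_assoc b, add_comm v.1]
  congr 1
  ring

lemma pauliOp_zero : pauliOp 0 = 1 := by
  refine pauliSpace_clm_ext fun b => ?_
  simp [pauliOp_basis, signPairing_zero_left]

lemma pauliOp_mul_self (v : PauliIndex) :
    pauliOp v * pauliOp v = signPairing v.2 v.1 • 1 := by
  rw [pauliOp_mul, ZModModule.add_self, pauliOp_zero]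

lemma pauliOp_star (v : PauliIndex) : star (pauliOp v) = signPairing v.2 v.1 • pauliOp v := by
  have h := congrArg (fun T => star (pauliOp v) * T) (pauliOp_mul_self v)
  have h1 : star (pauliOp v) * pauliOp v = 1 := Unitary.star_mul_self_of_mem (pauliUnitary v).2
  simp only [← mul_assoc, h1, one_mul, mul_smul_comm, mul_one] at h
  conv_rhs => rw [h, smul_smul, signPairing_mul_self, one_smul]

lemma pauliOp_comm (u v : PauliIndex) : pauliOp u * pauliOp v =
    (signPairing u.2 v.1 * signPairing v.2 u.1) • (pauliOp v * pauliOp u) := by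
  rw [pauliOp_mul, pauliOp_mul, smul_smul, mul_assoc, signPairing_mul_self, mul_one, add_comm u v]

/-! ### The algebra generated by the Pauli operators -/

/-- The linear span of the Pauli operators, which is a ⋆-algebra. -/
noncomputable def pauliSpan : StarSubalgebra ℂ (PauliSpace →L[ℂ] PauliSpace) where
  carrier := Submodule.span ℂ (Set.range pauliOp)
  mul_mem' {x y} hx hy := by
    rw [SetLike.mem_coe] at hx hy ⊢
    induction hx, hy using Submodule.span_induction₂ with
    | mem_mem x y hx hy =>
      obtain ⟨u, rfl⟩ := hx
      obtain ⟨v, rfl⟩ := hy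
      rw [pauliOp_mul]
      exact Submodule.smul_mem _ _ (Submodule.subset_span ⟨_, rfl⟩)
    | zero_left y hy => simp
    | zero_right x hx => simp
    | add_left x y z _ _ _ h₁ h₂ => rw [add_mul]; exact Submodule.add_mem _ h₁ h₂
    | add_right x y z _ _ _ h₁ h₂ => rw [mul_add]; exact Submodule.add_mem _ h₁ h₂
    | smul_left r x y _ _ h => rw [smul_mul_assoc]; exact Submodule.smul_mem _ _ h
    | smul_right r x y _ _ h => rw [mul_smul_comm]; exact Submodule.smul_mem _ _ h
  add_mem' := Submodule.add_mem _
  algebraMap_mem' c := by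
    rw [Algebra.algebraMap_eq_smul_one, ← pauliOp_zero]
    exact Submodule.smul_mem _ _ (Submodule.subset_span ⟨_, rfl⟩)
  star_mem' {x} hx := by
    rw [SetLike.mem_coe] at hx ⊢
    induction hx using Submodule.span_induction with
    | mem x hx =>
      obtain ⟨v, rfl⟩ := hx
      rw [pauliOp_star]
      exact Submodule.smul_mem _ _ (Submodule.subset_span ⟨_, rfl⟩)
    | zero => simp
    | add x y _ _ hx hy => rw [star_add]; exact Submodule.add_mem _ hx hy
    | smul c x _ hx => rw [star_smul]; exact Submodule.smul_mem _ _ hx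

/-- The C⋆-algebra generated by the Pauli operators. -/
abbrev PauliAlgebra : Type := pauliSpan.topologicalClosure

instance : IsClosed (pauliSpan.topologicalClosure : Set (PauliSpace →L[ℂ] PauliSpace)) :=
  pauliSpan.isClosed_topologicalClosure

noncomputable instance : CStarAlgebra PauliAlgebra :=
  StarSubalgebra.cstarAlgebra pauliSpan.topologicalClosure

/-- The Pauli operators as elements of the algebra which they generate. -/
noncomputable def pauli (v : PauliIndex) : PauliAlgebra :=
  ⟨pauliOp v, pauliSpan.le_topologicalClosure (Submodule.subset_span ⟨v, rfl⟩)⟩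

instance : Nontrivial PauliSpace :=
  ⟨pauliBasis 0, 0, fun h => by simpa [h] using pauliBasis.orthonormal.1 0⟩

instance : Nontrivial PauliAlgebra :=
  ⟨0, 1, fun h => zero_ne_one (α := PauliSpace →L[ℂ] PauliSpace) (congrArg Subtype.val h)⟩

lemma pauli_mul (u v : PauliIndex) :
    pauli u * pauli v = signPairing u.2 v.1 • pauli (u + v) := Subtype.ext (pauliOp_mul u v)

lemma pauli_zero : pauli 0 = 1 := Subtype.ext pauliOp_zero

lemma pauli_star (v : PauliIndex) : star (pauli v) = signPairing v.2 v.1 • pauli v :=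
  Subtype.ext (pauliOp_star v)

theorem isPauliSystem_pauli :
    IsPauliSystem pauli fun u v => signPairing u.2 v.1 * signPairing v.2 u.1 where
  unitary v := Unitary.mem_iff.2 ⟨Subtype.ext (Unitary.star_mul_self_of_mem (pauliUnitary v).2),
    Subtype.ext (Unitary.mul_star_self_of_mem (pauliUnitary v).2)⟩
  mul_eq u v := ⟨_, pauli_mul u v⟩
  star_eq v := ⟨_, pauli_star v⟩
  comm u v := Subtype.ext (pauliOp_comm u v)
  sign u v := by
    rcases signPairing_eq u.2 v.1 with h | h <;> rcases signPairing_eq v.2 u.1 with h' | h' <;>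
      simp [h, h']
  separates u v huv := by
    by_contra! h
    refine huv (sub_eq_zero.1 ?_)
    rw [ZModModule.sub_eq_add]
    refine Prod.ext ?_ ?_
    · by_contra hne
      obtain ⟨g, hg⟩ := exists_signPairing_left hne
      have := h (0, g)
      simp only [signPairing_zero_right, mul_one] at this
      rw [Prod.fst_add, signPairing_add_right, this, signPairing_mul_self] at hg
      norm_num at hg
    · by_contra hne
      obtain ⟨a, ha⟩ := exists_signPairing_right hne
      have := h (a, 0)
      simp only [signPairing_zero_left, one_mul] at this
      rw [Prod.snd_add, signPairing_add_left, this, signPairing_mul_self] at ha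
      norm_num at ha
  dense := by
    rw [Subtype.dense_iff]
    intro x hx
    change x ∈ closure (pauliSpan : Set (PauliSpace →L[ℂ] PauliSpace)) at hx
    refine closure_mono ?_ hx
    intro y hy
    change y ∈ Submodule.span ℂ (Set.range pauliOp) at hy
    induction hy using Submodule.span_induction with
    | mem y hy =>
      obtain ⟨v, rfl⟩ := hy
      exact ⟨pauli v, Submodule.subset_span ⟨v, rfl⟩, rfl⟩
    | zero => exact ⟨0, Submodule.zero_mem _, rfl⟩
    | add y z _ _ hy hz =>
      obtain ⟨y', hy', rfl⟩ := hy
      obtain ⟨z', hz', rfl⟩ := hz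
      exact ⟨y' + z', Submodule.add_mem _ hy' hz', rfl⟩
    | smul c y _ hy =>
      obtain ⟨y', hy', rfl⟩ := hy
      exact ⟨c • y', Submodule.smul_mem _ c hy', rfl⟩

/-! ### Two inequivalent pure states -/

/-- The vector functional `x ↦ ⟪η, x η⟫`. -/
noncomputable def vectorFunctional (η : PauliSpace) : StrongDual ℂ PauliAlgebra :=
  LinearMap.mkContinuous
    { toFun := fun x => inner ℂ η ((x : PauliSpace →L[ℂ] PauliSpace) η)
      map_add' := fun x y => by simp
      map_smul' := fun c x => by simp } (‖η‖ ^ 2) fun x => by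
    refine (norm_inner_le_norm (𝕜 := ℂ) η ((x : PauliSpace →L[ℂ] PauliSpace) η)).trans ?_
    have h := (x : PauliSpace →L[ℂ] PauliSpace).le_opNorm η
    calc _ ≤ ‖η‖ * (‖(x : PauliSpace →L[ℂ] PauliSpace)‖ * ‖η‖) := by gcongr
      _ = ‖η‖ ^ 2 * ‖(x : PauliSpace →L[ℂ] PauliSpace)‖ := by ring

lemma vectorFunctional_apply (η : PauliSpace) (x : PauliAlgebra) :
    vectorFunctional η x = inner ℂ η ((x : PauliSpace →L[ℂ] PauliSpace) η) := rfl

lemma vectorFunctional_star_mul_self (η : PauliSpace) (x : PauliAlgebra) :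
    vectorFunctional η (star x * x) = (‖(x : PauliSpace →L[ℂ] PauliSpace) η‖ : ℂ) ^ 2 := by
  have h : ((star x * x : PauliAlgebra) : PauliSpace →L[ℂ] PauliSpace) η =
      (ContinuousLinearMap.adjoint (x : PauliSpace →L[ℂ] PauliSpace))
        ((x : PauliSpace →L[ℂ] PauliSpace) η) := rfl
  rw [vectorFunctional_apply, h, ContinuousLinearMap.adjoint_inner_right,
    inner_self_eq_norm_sq_to_K]
  rfl

lemma vectorFunctional_one {η : PauliSpace} (hη : ‖η‖ = 1) : vectorFunctional η 1 = 1 := by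
  have h : vectorFunctional η 1 = inner ℂ η η := rfl
  rw [h, inner_self_eq_norm_sq_to_K, hη]
  simp

lemma vectorFunctional_mem_stateSpace {η : PauliSpace} (hη : ‖η‖ = 1) :
    vectorFunctional η ∈ stateSpace PauliAlgebra := by
  refine ⟨fun x => ?_, le_antisymm ?_ ?_⟩
  · rw [vectorFunctional_star_mul_self]
    exact_mod_cast sq_nonneg ‖(x : PauliSpace →L[ℂ] PauliSpace) η‖
  · refine (LinearMap.mkContinuous_norm_le _ (by positivity) _).trans ?_
    rw [hη, one_pow]
  · have h := (vectorFunctional η).le_opNorm 1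
    rwa [vectorFunctional_one hη, norm_one, CStarRing.norm_one, mul_one] at h

/-- The vector state at the basis vector `pauliBasis 0`, which is fixed by the multiplications, is
pure. -/
lemma vectorFunctional_basis_mem_pureStateSpace :
    vectorFunctional (pauliBasis 0) ∈ pureStateSpace PauliAlgebra := by
  have h0 : ‖pauliBasis 0‖ = 1 := pauliBasis.orthonormal.1 0
  refine isPauliSystem_pauli.mem_pureStateSpace (vectorFunctional_mem_stateSpace h0)
    (vectorFunctional_one h0) (L := {v | v.1 = 0}) (fun l hl => ?_) (fun l hl => ?_)
    fun v hv => ?_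
  · rw [pauli_star, show l.1 = 0 from hl, signPairing_zero_right, one_smul]
  · have h : vectorFunctional (pauliBasis 0) (pauli l) =
      inner ℂ (pauliBasis 0) (pauliOp l (pauliBasis 0)) := rfl
    rw [h, pauliOp_basis, show l.1 = 0 from hl, signPairing_zero_right, one_smul, add_zero,
      inner_self_eq_norm_sq_to_K, h0]
    simp
  · obtain ⟨g, hg⟩ := exists_signPairing_left hv
    exact ⟨(0, g), rfl, by simp [hg, signPairing_zero_right]⟩

/-- A limit of the vector states at normalized indicator functions of finite subgroups takes the
value `1` on all translations: every finite set of translations fixes such a vector. -/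
lemma exists_state_translation : ∃ ψ ∈ stateSpace PauliAlgebra, ψ 1 = 1 ∧
    ∀ a, ψ (pauli (a, 0)) = 1 := by
  classical
  choose t hts hadd using fun s : Finset (ℕ →₀ ZMod 2) =>
    exists_finset_superset_add_mem (V := ℕ →₀ ZMod 2) (insert 0 s)
  let ξ : Finset (ℕ →₀ ZMod 2) → PauliSpace := fun s => ∑ b ∈ t s, pauliBasis b
  have hξ (s) : ξ s ≠ 0 := by
    intro h
    have h1 : inner ℂ (pauliBasis 0) (ξ s) = 1 := by
      simp only [ξ, inner_sum, orthonormal_iff_ite.1 pauliBasis.orthonormal]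
      rw [Finset.sum_ite_eq, if_pos (hts s (Finset.mem_insert_self 0 s))]
    rw [h, inner_zero_right] at h1
    exact zero_ne_one h1
  let η : Finset (ℕ →₀ ZMod 2) → PauliSpace := fun s => ((‖ξ s‖ : ℂ)⁻¹) • ξ s
  have hη (s) : ‖η s‖ = 1 := norm_smul_inv_norm (hξ s)
  have hfix (s) (a) (ha : a ∈ s) : pauliOp (a, 0) (η s) = η s := by
    have ha' : a ∈ t s := hts s (Finset.mem_insert_of_mem ha)
    simp only [η, ξ, map_smul, map_sum, pauliOp_basis, signPairing_zero_left, one_smul]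
    congr 1
    exact Finset.sum_nbij' (fun b => b + a) (fun b => b + a) (fun b hb => hadd s b hb a ha')
      (fun b hb => hadd s b hb a ha') (fun b _ => finsupp_add_add_cancel a b)
      (fun b _ => finsupp_add_add_cancel a b) (fun b _ => rfl)
  obtain ⟨ψ, hψ, h⟩ := exists_state_of_eventually Filter.atTop (fun s => vectorFunctional (η s))
    (fun s => vectorFunctional_mem_stateSpace (hη s)) (fun s => vectorFunctional_one (hη s))
  refine ⟨ψ, hψ, h _ _ (.of_forall fun s => vectorFunctional_one (hη s)), fun a => h _ _ ?_⟩
  filter_upwards [Filter.eventually_ge_atTop {a}] with s hs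
  have e : vectorFunctional (η s) (pauli (a, 0)) = inner ℂ (η s) (pauliOp (a, 0) (η s)) := rfl
  rw [e, hfix s a (hs (Finset.mem_singleton_self a)), inner_self_eq_norm_sq_to_K, hη]
  simp

instance : TopologicalSpace.SeparableSpace PauliSpace := by
  rw [← TopologicalSpace.isSeparable_univ_iff]
  have h := ((Set.countable_range pauliBasis).isSeparable.span (R := ℂ)).closure
  rwa [(Submodule.dense_iff_topologicalClosure_eq_top.2 pauliBasis.dense_span).closure_eq] at h

/-- An automorphism intertwining the two pure states would embed the uncountably many
multiplications as a separated family into the separable space. -/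
theorem not_hasHomogeneousPureStateSpace_pauliAlgebra :
    ¬ HasHomogeneousPureStateSpace PauliAlgebra := by
  intro hom
  obtain ⟨ψ, hψ, hψ1, hψa⟩ := exists_state_translation
  have hstar (l : PauliIndex) (hl : l ∈ {v : PauliIndex | v.2 = 0}) :
      star (pauli l) = pauli l := by
    rw [pauli_star, show l.2 = 0 from hl, signPairing_zero_left, one_smul]
  have hψL (l : PauliIndex) (hl : l ∈ {v : PauliIndex | v.2 = 0}) : ψ (pauli l) = 1 := by
    rw [show l = (l.1, 0) from Prod.ext rfl hl]
    exact hψa l.1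
  have hmax (v : PauliIndex) (hv : v ∉ {v : PauliIndex | v.2 = 0}) :
      ∃ l ∈ {v : PauliIndex | v.2 = 0}, signPairing l.2 v.1 * signPairing v.2 l.1 = -1 := by
    obtain ⟨a, ha⟩ := exists_signPairing_right hv
    exact ⟨(a, 0), rfl, by simp [ha, signPairing_zero_left]⟩
  have hψpure : ψ ∈ pureStateSpace PauliAlgebra :=
    isPauliSystem_pauli.mem_pureStateSpace hψ hψ1 hstar hψL hmax
  obtain ⟨α, hα⟩ := hom _ vectorFunctional_basis_mem_pureStateSpace ψ hψpure
  let T : PauliAlgebra →ₗ[ℂ] PauliSpace :=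
    { toFun := fun x => (α x : PauliSpace →L[ℂ] PauliSpace) (pauliBasis 0)
      map_add' := fun x y => by simp
      map_smul' := fun c x => by simp }
  have : Uncountable (ℕ → ZMod 2) := by
    rw [← Cardinal.aleph0_lt_mk_iff]
    simpa using Cardinal.aleph0_lt_continuum
  refine no_uncountable_separated T (φ := ψ) (fun x => ?_)
    (fun g : ℕ → ZMod 2 => pauli (0, g)) fun g h hgh => ?_
  · rw [← hα, map_mul, map_star, vectorFunctional_star_mul_self]
    rfl
  · have hs (g : ℕ → ZMod 2) : star (pauli (0, g)) = pauli (0, g) := by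
      rw [pauli_star, signPairing_zero_right, one_smul]
    have hm (g h : ℕ → ZMod 2) : pauli (0, g) * pauli (0, h) = pauli (0, g + h) := by
      rw [pauli_mul, signPairing_zero_right, one_smul, Prod.mk_add_mk, add_zero]
    have hz (g h : ℕ → ZMod 2) (hgh : g ≠ h) : ψ (pauli (0, g + h)) = 0 := by
      have hne : ((0, g + h) : PauliIndex) ∉ {v : PauliIndex | v.2 = 0} := by
        rw [← ZModModule.sub_eq_add]
        exact fun h0 => hgh (sub_eq_zero.1 h0)
      obtain ⟨l, hl, hlv⟩ := hmax _ hne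
      exact isPauliSystem_pauli.state_apply_eq_zero hψ hψ1 (hstar l hl) (hψL l hl) hlv
    rw [star_sub, hs, hs, mul_sub, sub_mul, sub_mul, hm, hm, hm, hm, map_sub, map_sub, map_sub,
      hz g h hgh, hz h g hgh.symm, ZModModule.add_self, ZModModule.add_self,
      show ((0, 0) : PauliIndex) = 0 from rfl, pauli_zero, hψ1]
    norm_num

theorem mainTheorem2 :
    ∃ (A : Type) (_ : NonUnitalCStarAlgebra A),
      IsSimpleCStarAlgebra A ∧ IsNuclear.{0, v} A ∧ ¬ HasHomogeneousPureStateSpace A ∧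
        HasFaithfulSeparableRepresentation A := by
  refine ⟨PauliAlgebra, inferInstance, isPauliSystem_pauli.isSimpleCStarAlgebra,
    isPauliSystem_pauli.isNuclear, not_hasHomogeneousPureStateSpace_pauliAlgebra,
    PauliSpace, inferInstance, inferInstance, inferInstance, inferInstance,
    (pauliSpan.topologicalClosure.subtype : PauliAlgebra →⋆ₙₐ[ℂ] (PauliSpace →L[ℂ] PauliSpace)),
    Subtype.val_injective⟩
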